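/- Let $K$ be an algebraically closed field (of any characteristic), let $n\ge 0$, let $F_n=K\langle z_1,\dots,z_n\rangle$ be the free associative unital $K$-algebra on $n$ generators, and let $\mathbb{T}_n=(K^\times)^n$ be the $n$-dimensional algebraic torus. An action of $\mathbb{T}_n$ on $F_n$ is a group homomorphism $\sigma:\mathbb{T}_n\to\operatorname{Aut}_K F_n$. It is regular if for every $f\in F_n$ there are elements $f_m\in F_n$ ($m\in\mathbb{Z}^n$), all but finitely many of them zero, such that $\sigma(t)(f)=\sum_{m\in\mathbb{Z}^n} t_1^{m_1}\cdots t_n^{m_n}f_m$ for all $t=(t_1,\dots,t_n)\in\mathbb{T}_n$. It is effective if for every $t\neq 1$ in $\mathbb{T}_n$ there is $f\in F_n$ with $\sigma(t)(f)\ne f$. Every effective regular action $\sigma$ of $\mathbb{T}_n$ on $F_n$ is linearizable: there are an automorphism $\beta\in\operatorname{Aut}_K F_n$ and an action $\tau:\mathbb{T}_n\to\operatorname{Aut}_K F_n$ of the diagonal linear form $$\tau(t)(z_i)=t_1^{m_{i1}}\cdots t_n^{m_{in}}\,z_i\qquad(t\in\mathbb{T}_n,\ 1\le i\le n),$$ with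 integers $m_{ij}$ that do not depend on $t$, such that $\tau(t)=\beta^{-1}\circ\sigma(t)\circ\beta$ for all $t\in\mathbb{T}_n$. -/

import Mathlib

namespace FreeTorus

/-- The `n`-dimensional algebraic torus `(K^×)^n`, with coordinatewise multiplication. -/
abbrev Torus (K : Type*) [Field K] (n : ℕ) : Type _ := Fin n → Kˣ

/-- The Laurent monomial `t_1 ^ m_1 ⋯ t_n ^ m_n`. -/
def laurentMonomial {K : Type*} [Field K] {n : ℕ} (m : Fin n → ℤ) (t : Torus K n) : K :=
  ((∏ j, t j ^ m j : Kˣ) : K)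

/-- An action of the torus by automorphisms of a `K`-algebra `A` is regular if for each `a : A` the
element `σ t a` is a Laurent polynomial in the coordinates of `t`, with coefficients in `A`. -/
def IsRegularAction {K : Type*} [Field K] {n : ℕ} {A : Type*} [Ring A] [Algebra K A]
    (σ : Torus K n →* (A ≃ₐ[K] A)) : Prop :=
  ∀ a : A, ∃ c : (Fin n → ℤ) →₀ A, ∀ t : Torus K n,
    σ t a = c.sum fun m x => laurentMonomial m t • x

/-- An action is effective if every `t ≠ 1` moves some element. -/
def IsEffectiveAction {K : Type*} [Field K] {n : ℕ} {A : Type*} [Ring A] [Algebra K A]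
    (σ : Torus K n →* (A ≃ₐ[K] A)) : Prop :=
  ∀ t : Torus K n, t ≠ 1 → ∃ a : A, σ t a ≠ a

/-- An action on the free algebra `K⟨z_1, …, z_n⟩` is diagonal linear if there is an integer matrix
`m` with `σ t z_i = (∏ j, t_j ^ m_{ij}) z_i` for all `t` and `i`. -/
def IsDiagonalLinearAction {K : Type*} [Field K] {n : ℕ}
    (σ : Torus K n →* (FreeAlgebra K (Fin n) ≃ₐ[K] FreeAlgebra K (Fin n))) : Prop :=
  ∃ m : Fin n → Fin n → ℤ, ∀ (t : Torus K n) (i : Fin n),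
    σ t (FreeAlgebra.ι K i) = laurentMonomial (m i) t • FreeAlgebra.ι K i

/-- An action on the free algebra is linearizable if it is conjugate, by one automorphism `β` of the
free algebra, to a diagonal linear action. Multiplication of automorphisms is composition. -/
def IsLinearizable {K : Type*} [Field K] {n : ℕ}
    (σ : Torus K n →* (FreeAlgebra K (Fin n) ≃ₐ[K] FreeAlgebra K (Fin n))) : Prop :=
  ∃ (β : FreeAlgebra K (Fin n) ≃ₐ[K] FreeAlgebra K (Fin n))
    (τ : Torus K n →* (FreeAlgebra K (Fin n) ≃ₐ[K] FreeAlgebra K (Fin n))),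
    IsDiagonalLinearAction τ ∧ ∀ t : Torus K n, τ t = β⁻¹ * σ t * β

end FreeTorus

/-! Regularity and Dedekind's independence of characters make the free algebra the direct sum of its
weight spaces. The proof finds a fixed point, moves it to the origin, picks weight vectors tangent
to the generators, and shows that they are free generators.

Fixed point (`exists_invariant_augmentation`, `exists_invariant_point`). The action descends to the
commutative polynomial ring and stays effective there. Effectiveness gives nonzero weight vectors
with `n` independent weights. A transcendental invariant would join them to form `n + 1`
algebraically independent elements, so every invariant is algebraic, hence constant. As the units
are constants too, the nonzero weights span an ideal: an invariant maximal ideal with residue field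
`K`.

Linearization (`exists_weight_of_order`, `bijective_lift_of_weight_vectors`). Once the origin is
fixed, a linear change of variables yields weight vectors `u_i = z_i + (order ≥ 2)` of weights
`w_i`. The substitution `z_i ↦ u_i` preserves leading forms, so it is injective, and it intertwines
a diagonal action with the given one. The leading form of a weight vector involves only words of
that same weight. By effectiveness the `w_i` are independent, so a weight determines the length of
its words, and hence the order of every nonzero vector of that weight. Matching the leading form of
a weight vector by an element of the range leaves a remainder of the same weight and higher order,
which must vanish. This gives surjectivity without any degree bound or completion. -/

namespace FreeTorus

open Module

/-! ### Characters of the torus and weight decompositions -/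

section Weights

variable {K : Type*} [Field K] {n : ℕ}

theorem laurentMonomial_mul (m : Fin n → ℤ) (s t : Torus K n) :
    laurentMonomial m (s * t) = laurentMonomial m s * laurentMonomial m t := by
  simp [laurentMonomial, mul_zpow, Finset.prod_mul_distrib]

theorem laurentMonomial_one (m : Fin n → ℤ) : laurentMonomial m (1 : Torus K n) = 1 := by
  simp [laurentMonomial]

theorem laurentMonomial_add (m m' : Fin n → ℤ) (t : Torus K n) :
    laurentMonomial (m + m') t = laurentMonomial m t * laurentMonomial m' t := by
  simp [laurentMonomial, zpow_add, Finset.prod_mul_distrib]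

theorem laurentMonomial_zero (t : Torus K n) : laurentMonomial 0 t = 1 := by
  simp [laurentMonomial]

theorem laurentMonomial_pow (m v : Fin n → ℤ) (a : Kˣ) :
    laurentMonomial m (fun j => a ^ v j) = ((a ^ (∑ j, m j * v j) : Kˣ) : K) := by
  have h : ∀ s : Finset (Fin n), ∏ j ∈ s, (a ^ v j) ^ m j = a ^ ∑ j ∈ s, m j * v j := by
    intro s
    induction s using Finset.cons_induction with
    | empty => simp
    | cons i s hi ih => rw [Finset.prod_cons, Finset.sum_cons, zpow_add, ih, mul_comm, ← zpow_mul,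
        mul_comm (v i), mul_comm]
  simp [laurentMonomial, h]

/-- A Laurent monomial as a character of the torus. -/
def laurentCharacter (K : Type*) [Field K] {n : ℕ} (m : Fin n → ℤ) : Torus K n →* K where
  toFun := laurentMonomial m
  map_one' := laurentMonomial_one m
  map_mul' := laurentMonomial_mul m

/-- Otherwise every unit would be a root of unity of order dividing `|d|`, and a field has finitely
many of these. -/
theorem exists_zpow_ne_one [Infinite K] {d : ℤ} (hd : d ≠ 0) : ∃ a : Kˣ, a ^ d ≠ 1 := by
  by_contra! h
  have hpos : 0 < d.natAbs := Int.natAbs_pos.mpr hd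
  have h' : ∀ a : Kˣ, a ^ d.natAbs = 1 := fun a => by
    rcases Int.natAbs_eq d with e | e
    · have := h a
      rw [e, zpow_natCast] at this
      exact this
    · have := h a
      rw [e, zpow_neg, zpow_natCast, inv_eq_one] at this
      exact this
  have : NeZero d.natAbs := ⟨hpos.ne'⟩
  have hfin : Finite (rootsOfUnity d.natAbs K) := inferInstance
  have htop : rootsOfUnity d.natAbs K = ⊤ := by
    ext a
    simp [mem_rootsOfUnity, h' a]
  rw [htop] at hfin
  have : Finite Kˣ := Finite.of_equiv _ (Subgroup.topEquiv (G := Kˣ)).toEquiv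
  have h0 : (insert 0 (Set.range ((↑) : Kˣ → K))).Finite := (Set.finite_range _).insert 0
  refine Set.infinite_univ (α := K) (h0.subset fun x _ => ?_)
  rcases eq_or_ne x 0 with rfl | hx
  · exact Set.mem_insert _ _
  · exact Set.mem_insert_of_mem _ ⟨Units.mk0 x hx, rfl⟩

/-- The point lies on the one-parameter subgroup `a ↦ (a ^ v_j)`, on which `t ^ m` becomes `a ^ ⟨m,
v⟩`. Effectiveness is always exploited through such points. -/
theorem exists_torus_ne_one [Infinite K] {v : Fin n → ℤ} (hv : v ≠ 0) :
    ∃ t : Torus K n, t ≠ 1 ∧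
      ∀ m : Fin n → ℤ, ∑ j, m j * v j = 0 → laurentMonomial m t = 1 := by
  obtain ⟨j, hj⟩ := Function.ne_iff.mp hv
  obtain ⟨a, ha⟩ := exists_zpow_ne_one (K := K) hj
  refine ⟨fun j => a ^ v j, fun h => ha (congrFun h j), fun m hm => ?_⟩
  rw [laurentMonomial_pow, hm]
  simp

theorem laurentCharacter_injective [Infinite K] :
    Function.Injective (laurentCharacter K (n := n)) := by
  intro m m' h
  ext j
  by_contra hne
  obtain ⟨a, ha⟩ := exists_zpow_ne_one (K := K) (sub_ne_zero.mpr hne)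
  apply ha
  have h1 := DFunLike.congr_fun h (fun i => a ^ (Pi.single j 1 : Fin n → ℤ) i)
  change laurentMonomial _ _ = laurentMonomial _ _ at h1
  rw [laurentMonomial_pow, laurentMonomial_pow] at h1
  have h2 := Units.ext h1
  simp only [Pi.single_apply, mul_ite, mul_one, mul_zero, Finset.sum_ite_eq', Finset.mem_univ,
    if_true] at h2
  rw [zpow_sub, h2, mul_inv_cancel]

/-- Dedekind's independence of characters, extended to vector coefficients by testing against linear
functionals. -/
theorem eq_zero_of_sum_laurentMonomial_smul_eq_zero [Infinite K] {V : Type*} [AddCommGroup V]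
    [Module K V] (s : Finset (Fin n → ℤ)) (c : (Fin n → ℤ) → V)
    (h : ∀ t : Torus K n, ∑ m ∈ s, laurentMonomial m t • c m = 0) : ∀ m ∈ s, c m = 0 := by
  intro m hm
  rw [← forall_dual_apply_eq_zero_iff K]
  intro φ
  have hli := (linearIndependent_monoidHom (Torus K n) K).comp _
    (laurentCharacter_injective (K := K) (n := n))
  refine linearIndependent_iff'.mp hli s (fun m => φ (c m)) ?_ m hm
  ext t
  have := congrArg φ (h t)
  simpa [laurentCharacter, mul_comm] using this

variable {A : Type*} [Ring A] [Algebra K A]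

/-- The elements on which the torus acts through the character `t ^ m`. -/
def weightSpace (ρ : Torus K n → A →ₐ[K] A) (m : Fin n → ℤ) : Submodule K A where
  carrier := {a | ∀ t, ρ t a = (laurentMonomial m t • a : A)}
  add_mem' ha hb t := by rw [map_add, ha t, hb t, smul_add]
  zero_mem' t := by simp
  smul_mem' c a ha t := by rw [map_smul, ha t, smul_comm]

theorem mem_weightSpace {ρ : Torus K n → A →ₐ[K] A} {m : Fin n → ℤ} {a : A} :
    a ∈ weightSpace ρ m ↔ ∀ t, ρ t a = (laurentMonomial m t • a : A) := Iff.rfl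

theorem mul_mem_weightSpace {ρ : Torus K n → A →ₐ[K] A} {m m' : Fin n → ℤ} {a b : A}
    (ha : a ∈ weightSpace (K := K) ρ m) (hb : b ∈ weightSpace ρ m') :
    a * b ∈ weightSpace ρ (m + m') := by
  intro t
  rw [map_mul, mem_weightSpace.mp ha t, mem_weightSpace.mp hb t, smul_mul_smul_comm,
    laurentMonomial_add]

theorem algebraMap_mem_weightSpace_zero (ρ : Torus K n → A →ₐ[K] A) (c : K) :
    algebraMap K A c ∈ weightSpace ρ 0 := by
  intro t
  rw [AlgHom.commutes, laurentMonomial_zero, one_smul]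

theorem one_mem_weightSpace_zero (ρ : Torus K n → A →ₐ[K] A) : (1 : A) ∈ weightSpace ρ 0 := by
  simpa using algebraMap_mem_weightSpace_zero ρ 1

theorem pow_mem_weightSpace {ρ : Torus K n → A →ₐ[K] A} {m : Fin n → ℤ} {a : A}
    (ha : a ∈ weightSpace ρ m) (k : ℕ) : a ^ k ∈ weightSpace ρ (k • m) := by
  induction k with
  | zero => simpa using one_mem_weightSpace_zero ρ
  | succ k ih =>
    rw [pow_succ, succ_nsmul]
    exact mul_mem_weightSpace ih ha

theorem iSupIndep_weightSpace [Infinite K] (ρ : Torus K n → A →ₐ[K] A) :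
    iSupIndep (weightSpace ρ) := by
  rw [iSupIndep_iff_finsetSum_eq_zero_imp_eq_zero]
  intro s v hv h
  refine eq_zero_of_sum_laurentMonomial_smul_eq_zero (K := K) s v fun t => ?_
  have := congrArg (ρ t) h
  rw [map_sum, map_zero] at this
  rw [← this]
  exact Finset.sum_congr rfl fun m hm => (hv m hm t).symm

/-- Comparing coefficients of the characters of `t` in `ρ (s * t) a = ρ s (ρ t a)` shows that the
Laurent coefficients of `a` are weight vectors; at `t = 1` they sum to `a`. -/
theorem iSup_weightSpace_eq_top [Infinite K] {ρ : Torus K n → A →ₐ[K] A}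
    (hone : ∀ a, ρ 1 a = a) (hmul : ∀ s t a, ρ (s * t) a = ρ s (ρ t a))
    (hreg : ∀ a : A, ∃ c : (Fin n → ℤ) →₀ A, ∀ t : Torus K n,
      ρ t a = c.sum fun m x => laurentMonomial m t • x) : ⨆ m, weightSpace ρ m = ⊤ := by
  rw [eq_top_iff]
  intro a _
  obtain ⟨c, hc⟩ := hreg a
  have hmem : ∀ m ∈ c.support, c m ∈ weightSpace ρ m := by
    intro m hm s
    rw [← sub_eq_zero]
    refine eq_zero_of_sum_laurentMonomial_smul_eq_zero (K := K) c.support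
      (fun m => ρ s (c m) - laurentMonomial m s • c m) (fun t => ?_) m hm
    have h1 := hmul s t a
    rw [hc, hc, Finsupp.sum, Finsupp.sum, map_sum] at h1
    simp only [smul_sub, Finset.sum_sub_distrib]
    rw [sub_eq_zero]
    simp only [map_smul] at h1
    rw [← h1]
    refine Finset.sum_congr rfl fun m _ => ?_
    rw [laurentMonomial_mul, smul_smul, mul_comm]
  rw [← hone a, hc, Finsupp.sum]
  refine Submodule.sum_mem _ fun m hm => ?_
  rw [laurentMonomial_one, one_smul]
  exact Submodule.mem_iSup_of_mem m (hmem m hm)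

end Weights

theorem exists_linearIndependent_of_span_eq_top {k : Type*} [Field k] {n : ℕ}
    {s : Set (Fin n → k)} (hs : Submodule.span k s = ⊤) :
    ∃ u : Fin n → Fin n → k, (∀ i, u i ∈ s) ∧ LinearIndependent k u := by
  obtain ⟨b, hbs, hspan, hli⟩ := exists_linearIndependent k s
  have hb : ⊤ ≤ Submodule.span k (Set.range ((↑) : b → Fin n → k)) := by
    rw [Subtype.range_coe, hspan, hs]
  let B := Basis.mk hli hb
  have e : Fin n ≃ b := (Pi.basisFun k (Fin n)).indexEquiv B
  exact ⟨fun i => (e i : Fin n → k), fun i => hbs (e i).2, hli.comp _ e.injective⟩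

/-! ### Order filtration, leading forms and abelianization of the free algebra -/

section OrderFiltration

variable {K : Type*} [Field K] {X : Type*}

/-- The product of the generators along a word. -/
noncomputable def freeWord (K : Type*) [Field K] {X : Type*} : FreeMonoid X →* FreeAlgebra K X :=
  FreeMonoid.lift (FreeAlgebra.ι K)

theorem basisFreeMonoid_apply (w : FreeMonoid X) :
    FreeAlgebra.basisFreeMonoid K X w = freeWord K w := by
  simp [FreeAlgebra.basisFreeMonoid, freeWord, FreeAlgebra.equivMonoidAlgebraFreeMonoid,
    MonoidAlgebra.coeffLinearEquiv]

theorem freeWord_of (x : X) : freeWord K (FreeMonoid.of x) = FreeAlgebra.ι K x := by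
  simp [freeWord]

/-- The coefficient of a noncommutative polynomial at a word. -/
noncomputable def freeCoeff (w : FreeMonoid X) : FreeAlgebra K X →ₗ[K] K :=
  (FreeAlgebra.basisFreeMonoid K X).coord w

theorem freeCoeff_freeWord [DecidableEq (FreeMonoid X)] (w w' : FreeMonoid X) :
    freeCoeff w (freeWord K w') = if w' = w then 1 else 0 := by
  rw [← basisFreeMonoid_apply, freeCoeff, Basis.coord_apply, Basis.repr_self, Finsupp.single_apply]

theorem freeAlgebra_ext_freeCoeff {f g : FreeAlgebra K X} (h : ∀ w, freeCoeff w f = freeCoeff w g) :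
    f = g :=
  (FreeAlgebra.basisFreeMonoid K X).repr.injective (Finsupp.ext h)

theorem linearMap_ext_freeWord {V : Type*} [AddCommGroup V] [Module K V]
    {φ ψ : FreeAlgebra K X →ₗ[K] V} (h : ∀ w, φ (freeWord K w) = ψ (freeWord K w)) : φ = ψ :=
  (FreeAlgebra.basisFreeMonoid K X).ext fun w => by rw [basisFreeMonoid_apply, h]

/-- The noncommutative polynomials without terms of degree less than `k`. -/
noncomputable def orderFiltration (K : Type*) [Field K] (X : Type*) (k : ℕ) :
    Submodule K (FreeAlgebra K X) :=
  Submodule.span K (freeWord K '' {w | k ≤ w.length})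

theorem mem_orderFiltration_iff {k : ℕ} {f : FreeAlgebra K X} :
    f ∈ orderFiltration K X k ↔ ∀ w : FreeMonoid X, w.length < k → freeCoeff w f = 0 := by
  have : (freeWord K : FreeMonoid X → FreeAlgebra K X) = FreeAlgebra.basisFreeMonoid K X :=
    funext fun w => (basisFreeMonoid_apply w).symm
  rw [orderFiltration, this, Basis.mem_span_image]
  simp only [Set.subset_def, Finset.mem_coe, Finsupp.mem_support_iff, Set.mem_ofPred_eq]
  exact forall_congr' fun w => by rw [← not_imp_not, not_le, not_not]; rfl

theorem freeWord_mem_orderFiltration (w : FreeMonoid X) :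
    freeWord K w ∈ orderFiltration K X w.length :=
  Submodule.subset_span ⟨w, by simp, rfl⟩

theorem ι_mem_orderFiltration (x : X) : FreeAlgebra.ι K x ∈ orderFiltration K X 1 := by
  have h := freeWord_mem_orderFiltration (K := K) (FreeMonoid.of x)
  rwa [freeWord_of, FreeMonoid.length_of] at h

theorem orderFiltration_antitone : Antitone (orderFiltration K X) := fun _ _ h =>
  Submodule.span_mono (Set.image_mono fun _ hw => le_trans h hw)

theorem mem_orderFiltration_zero (f : FreeAlgebra K X) : f ∈ orderFiltration K X 0 :=
  mem_orderFiltration_iff.mpr fun _ h => absurd h (Nat.not_lt_zero _)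

theorem mul_mem_orderFiltration {k l : ℕ} {f g : FreeAlgebra K X} (hf : f ∈ orderFiltration K X k)
    (hg : g ∈ orderFiltration K X l) : f * g ∈ orderFiltration K X (k + l) := by
  have h := Submodule.mul_mem_mul hf hg
  rw [orderFiltration, orderFiltration, Submodule.span_mul_span] at h
  refine Submodule.span_mono ?_ h
  rintro _ ⟨_, ⟨v, hv, rfl⟩, _, ⟨w, hw, rfl⟩, rfl⟩
  refine ⟨v * w, ?_, map_mul _ _ _⟩
  simp only [Set.mem_ofPred_eq, FreeMonoid.length_mul] at *
  omega

theorem exists_order {f : FreeAlgebra K X} (hf : f ≠ 0) :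
    ∃ k, f ∈ orderFiltration K X k ∧ f ∉ orderFiltration K X (k + 1) := by
  by_contra! h
  apply hf
  have hall : ∀ k, f ∈ orderFiltration K X k := fun k => by
    induction k with
    | zero => exact mem_orderFiltration_zero f
    | succ k ih => exact h k ih
  refine freeAlgebra_ext_freeCoeff fun w => ?_
  rw [map_zero]
  exact mem_orderFiltration_iff.mp (hall (w.length + 1)) w (Nat.lt_succ_self _)

theorem map_freeWord_mem {φ : FreeAlgebra K X →ₐ[K] FreeAlgebra K X}
    (hφ : ∀ x, φ (FreeAlgebra.ι K x) ∈ orderFiltration K X 1) (w : FreeMonoid X) :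
    φ (freeWord K w) ∈ orderFiltration K X w.length := by
  induction w using FreeMonoid.inductionOn' with
  | one => exact mem_orderFiltration_zero _
  | of_mul x w ih =>
    rw [map_mul, map_mul, freeWord_of, FreeMonoid.length_mul, FreeMonoid.length_of]
    exact mul_mem_orderFiltration (hφ x) ih

theorem map_mem_orderFiltration {φ : FreeAlgebra K X →ₐ[K] FreeAlgebra K X}
    (hφ : ∀ x, φ (FreeAlgebra.ι K x) ∈ orderFiltration K X 1) {k : ℕ} {f : FreeAlgebra K X}
    (hf : f ∈ orderFiltration K X k) : φ f ∈ orderFiltration K X k := by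
  induction hf using Submodule.span_induction with
  | mem f hf =>
    obtain ⟨w, hw, rfl⟩ := hf
    exact orderFiltration_antitone hw (map_freeWord_mem hφ w)
  | zero => rw [map_zero]; exact zero_mem _
  | add f g _ _ hf hg => rw [map_add]; exact add_mem hf hg
  | smul c f _ hf => rw [map_smul]; exact Submodule.smul_mem _ _ hf

/-- An endomorphism which is the identity to first order preserves leading forms. -/
theorem map_sub_self_mem_orderFiltration {φ : FreeAlgebra K X →ₐ[K] FreeAlgebra K X}
    (hφ : ∀ x, φ (FreeAlgebra.ι K x) - FreeAlgebra.ι K x ∈ orderFiltration K X 2) {k : ℕ}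
    {f : FreeAlgebra K X} (hf : f ∈ orderFiltration K X k) :
    φ f - f ∈ orderFiltration K X (k + 1) := by
  have hφ1 : ∀ x, φ (FreeAlgebra.ι K x) ∈ orderFiltration K X 1 := fun x => by
    have := add_mem (orderFiltration_antitone one_le_two (hφ x)) (ι_mem_orderFiltration x)
    rwa [sub_add_cancel] at this
  have hword : ∀ w : FreeMonoid X,
      φ (freeWord K w) - freeWord K w ∈ orderFiltration K X (w.length + 1) := by
    intro w
    induction w using FreeMonoid.inductionOn' with
    | one => simp
    | of_mul x w ih =>
      have e : φ (freeWord K (FreeMonoid.of x * w)) - freeWord K (FreeMonoid.of x * w) =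
          φ (FreeAlgebra.ι K x) * (φ (freeWord K w) - freeWord K w) +
            (φ (FreeAlgebra.ι K x) - FreeAlgebra.ι K x) * freeWord K w := by
        rw [map_mul, map_mul, freeWord_of]
        noncomm_ring
      rw [e, FreeMonoid.length_mul, FreeMonoid.length_of]
      refine add_mem ?_ ?_
      · have := mul_mem_orderFiltration (hφ1 x) ih
        rwa [← add_assoc] at this
      · have := mul_mem_orderFiltration (hφ x) (freeWord_mem_orderFiltration w)
        rwa [show 1 + w.length + 1 = 2 + w.length by omega]
  induction hf using Submodule.span_induction with
  | mem f hf =>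
    obtain ⟨w, hw, rfl⟩ := hf
    exact orderFiltration_antitone (Nat.succ_le_succ hw) (hword w)
  | zero => simp
  | add f g _ _ hf hg =>
    rw [map_add, add_sub_add_comm]
    exact add_mem hf hg
  | smul c f _ hf =>
    rw [map_smul, ← smul_sub]
    exact Submodule.smul_mem _ _ hf

theorem injective_of_sub_mem_orderFiltration {φ : FreeAlgebra K X →ₐ[K] FreeAlgebra K X}
    (hφ : ∀ x, φ (FreeAlgebra.ι K x) - FreeAlgebra.ι K x ∈ orderFiltration K X 2) :
    Function.Injective φ := by
  rw [injective_iff_map_eq_zero]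
  intro f hf
  by_contra hne
  obtain ⟨k, hk, hk'⟩ := exists_order hne
  have := map_sub_self_mem_orderFiltration hφ hk
  rw [hf, zero_sub, neg_mem_iff] at this
  exact hk' this

/-- The leading form: the part of degree `k` of a polynomial of order at least `k`. -/
theorem exists_leadingForm {k : ℕ} {f : FreeAlgebra K X} (hf : f ∈ orderFiltration K X k) :
    ∃ g : FreeAlgebra K X, f - g ∈ orderFiltration K X (k + 1) ∧
      ∀ w : FreeMonoid X, w.length ≠ k → freeCoeff w g = 0 := by
  classical
  let b := FreeAlgebra.basisFreeMonoid K X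
  have hg : ∀ w, freeCoeff w (b.repr.symm ((b.repr f).filter fun w => w.length = k)) =
      if w.length = k then freeCoeff w f else 0 := fun w => by
    change b.repr (b.repr.symm _) w = _
    rw [LinearEquiv.apply_symm_apply, Finsupp.filter_apply]
    rfl
  refine ⟨b.repr.symm ((b.repr f).filter fun w => w.length = k), ?_, fun w hw => ?_⟩
  · rw [mem_orderFiltration_iff]
    intro w hw
    rw [map_sub, hg]
    split_ifs with h
    · exact sub_self _
    · rw [mem_orderFiltration_iff.mp hf w (by omega), sub_zero]
  · rw [hg, if_neg hw]

/-- The map from the free algebra to commutative polynomials. -/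
noncomputable def abelianization (K : Type*) [Field K] (X : Type*) :
    FreeAlgebra K X →ₐ[K] MvPolynomial X K :=
  FreeAlgebra.lift K MvPolynomial.X

theorem abelianization_ι (x : X) :
    abelianization K X (FreeAlgebra.ι K x) = MvPolynomial.X x := by
  simp [abelianization]

theorem abelianization_freeWord_isHomogeneous (w : FreeMonoid X) :
    (abelianization K X (freeWord K w)).IsHomogeneous w.length := by
  induction w using FreeMonoid.inductionOn' with
  | one => simpa using MvPolynomial.isHomogeneous_one X K
  | of_mul x w ih =>
    rw [map_mul, map_mul, freeWord_of, FreeMonoid.length_mul, FreeMonoid.length_of,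
      abelianization_ι]
    exact (MvPolynomial.isHomogeneous_X K x).mul ih

theorem freeCoeff_one_eq (f : FreeAlgebra K X) :
    freeCoeff 1 f = MvPolynomial.coeff 0 (abelianization K X f) := by
  classical
  have : freeCoeff 1 = (MvPolynomial.lcoeff K (0 : X →₀ ℕ)).comp (abelianization K X).toLinearMap := by
    refine linearMap_ext_freeWord fun w => ?_
    rw [freeCoeff_freeWord]
    change _ = MvPolynomial.coeff 0 (abelianization K X (freeWord K w))
    split_ifs with h
    · simp [h]
    · refine ((abelianization_freeWord_isHomogeneous w).coeff_eq_zero ?_).symm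
      rw [map_zero]
      intro h0
      exact h (FreeMonoid.length_eq_zero.mp h0.symm)
  exact LinearMap.congr_fun this f

/-- Distinct words of length at most one stay distinct monomials after abelianization, so linear
parts can be read off there. -/
theorem freeCoeff_of_eq (x : X) (f : FreeAlgebra K X) :
    freeCoeff (FreeMonoid.of x) f =
      MvPolynomial.coeff (Finsupp.single x 1) (abelianization K X f) := by
  classical
  have : freeCoeff (FreeMonoid.of x) =
      (MvPolynomial.lcoeff K (Finsupp.single x 1)).comp (abelianization K X).toLinearMap := by
    refine linearMap_ext_freeWord fun w => ?_
    rw [freeCoeff_freeWord]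
    change _ = MvPolynomial.coeff (Finsupp.single x 1) (abelianization K X (freeWord K w))
    by_cases h1 : w.length = 1
    · obtain ⟨y, rfl⟩ := FreeMonoid.length_eq_one.mp h1
      rw [freeWord_of, abelianization_ι, MvPolynomial.coeff_X]
      simp [FreeMonoid.of_injective.eq_iff, Finsupp.single_left_inj]
    · rw [(abelianization_freeWord_isHomogeneous w).coeff_eq_zero, if_neg]
      · rintro rfl
        exact h1 (FreeMonoid.length_of x)
      · rw [Finsupp.degree_single]
        exact fun h => h1 h.symm
  exact LinearMap.congr_fun this f

theorem mem_orderFiltration_two_iff {f : FreeAlgebra K X} : f ∈ orderFiltration K X 2 ↔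
    freeCoeff 1 f = 0 ∧ ∀ x, freeCoeff (FreeMonoid.of x) f = 0 := by
  rw [mem_orderFiltration_iff]
  refine ⟨fun h => ⟨h 1 (by simp), fun x => h _ (by simp)⟩, fun h w hw => ?_⟩
  have : w.length = 0 ∨ w.length = 1 := by omega
  rcases this with h0 | h1
  · rw [FreeMonoid.length_eq_zero.mp h0, h.1]
  · obtain ⟨x, rfl⟩ := FreeMonoid.length_eq_one.mp h1
    exact h.2 x

theorem mem_orderFiltration_one_iff {f : FreeAlgebra K X} : f ∈ orderFiltration K X 1 ↔
    freeCoeff 1 f = 0 := by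
  rw [mem_orderFiltration_iff]
  refine ⟨fun h => h 1 (by simp), fun h w hw => ?_⟩
  rw [FreeMonoid.length_eq_zero.mp (Nat.lt_one_iff.mp hw), h]

theorem mem_orderFiltration_two_of_abelianization_eq_zero {f : FreeAlgebra K X}
    (hf : abelianization K X f = 0) : f ∈ orderFiltration K X 2 := by
  rw [mem_orderFiltration_two_iff]
  exact ⟨by rw [freeCoeff_one_eq, hf, MvPolynomial.coeff_zero],
    fun x => by rw [freeCoeff_of_eq, hf, MvPolynomial.coeff_zero]⟩

end OrderFiltration

/-! ### Weight vectors tangent to the generators -/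

section Core

variable {K : Type*} [Field K] {n : ℕ}

/-- The multiplicities of the letters in a word. -/
def letterCount {n : ℕ} (v : FreeMonoid (Fin n)) : Fin n → ℤ :=
  (FreeMonoid.lift (fun i => Multiplicative.ofAdd (Pi.single i 1 : Fin n → ℤ)) v).toAdd

theorem letterCount_one : letterCount (1 : FreeMonoid (Fin n)) = 0 := by
  simp [letterCount]

theorem letterCount_of_mul (i : Fin n) (v : FreeMonoid (Fin n)) :
    letterCount (FreeMonoid.of i * v) = Pi.single i 1 + letterCount v := by
  simp [letterCount]

theorem sum_letterCount (v : FreeMonoid (Fin n)) : ∑ i, letterCount v i = v.length := by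
  induction v using FreeMonoid.inductionOn' with
  | one => simp [letterCount_one]
  | of_mul i v ih =>
    simp [letterCount_of_mul, Finset.sum_add_distrib, ih]

/-- The endomorphism scaling the generators by the characters of weights `w i`. -/
noncomputable def diagonalEnd (w : Fin n → Fin n → ℤ) (t : Torus K n) :
    FreeAlgebra K (Fin n) →ₐ[K] FreeAlgebra K (Fin n) :=
  FreeAlgebra.lift K fun i => laurentMonomial (w i) t • FreeAlgebra.ι K i

theorem diagonalEnd_ι (w : Fin n → Fin n → ℤ) (t : Torus K n) (i : Fin n) :
    diagonalEnd w t (FreeAlgebra.ι K i) = laurentMonomial (w i) t • FreeAlgebra.ι K i := by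
  simp [diagonalEnd]

theorem diagonalEnd_freeWord (w : Fin n → Fin n → ℤ) (t : Torus K n) (v : FreeMonoid (Fin n)) :
    diagonalEnd w t (freeWord K v) =
      laurentMonomial (∑ i, letterCount v i • w i) t • freeWord K v := by
  induction v using FreeMonoid.inductionOn' with
  | one => simp [letterCount_one, laurentMonomial_zero]
  | of_mul i v ih =>
    rw [map_mul, map_mul, ih, freeWord_of, diagonalEnd_ι, smul_mul_smul_comm, letterCount_of_mul,
      ← laurentMonomial_add]
    simp only [Pi.add_apply, add_smul, Finset.sum_add_distrib]
    simp [Pi.single_apply]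

theorem freeCoeff_diagonalEnd (w : Fin n → Fin n → ℤ) (t : Torus K n) (v : FreeMonoid (Fin n))
    (f : FreeAlgebra K (Fin n)) : freeCoeff v (diagonalEnd w t f) =
      laurentMonomial (∑ i, letterCount v i • w i) t * freeCoeff v f := by
  classical
  have : (freeCoeff v).comp (diagonalEnd w t).toLinearMap =
      laurentMonomial (∑ i, letterCount v i • w i) t • freeCoeff v := by
    refine linearMap_ext_freeWord fun v' => ?_
    change freeCoeff v (diagonalEnd w t (freeWord K v')) =
      laurentMonomial (∑ i, letterCount v i • w i) t • freeCoeff v (freeWord K v')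
    rw [diagonalEnd_freeWord, map_smul, freeCoeff_freeWord]
    split_ifs with h
    · rw [h]
    · simp
  exact LinearMap.congr_fun this f

variable {ρ : Torus K n → FreeAlgebra K (Fin n) →ₐ[K] FreeAlgebra K (Fin n)}
  {u : Fin n → FreeAlgebra K (Fin n)} {w : Fin n → Fin n → ℤ}

theorem comp_lift_eq_lift_comp_diagonalEnd (hu : ∀ i, u i ∈ weightSpace ρ (w i)) (t : Torus K n)
    (f : FreeAlgebra K (Fin n)) :
    ρ t (FreeAlgebra.lift K u f) = FreeAlgebra.lift K u (diagonalEnd w t f) := by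
  have : (ρ t).comp (FreeAlgebra.lift K u) = (FreeAlgebra.lift K u).comp (diagonalEnd w t) := by
    ext i
    simp [diagonalEnd_ι, mem_weightSpace.mp (hu i) t]
  exact DFunLike.congr_fun this f

/-- A weight vector of order `k` has the weight of a word of length `k`, and agrees up to higher
order with a weight vector in the range of the substitution `z_i ↦ u_i`. -/
theorem exists_weight_of_order [Infinite K]
    (hJ : ∀ t i, ρ t (FreeAlgebra.ι K i) ∈ orderFiltration K (Fin n) 1)
    (hu : ∀ i, u i ∈ weightSpace ρ (w i))
    (hu2 : ∀ i, u i - FreeAlgebra.ι K i ∈ orderFiltration K (Fin n) 2) {m : Fin n → ℤ} {k : ℕ}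
    {f : FreeAlgebra K (Fin n)} (hfm : f ∈ weightSpace ρ m)
    (hfk : f ∈ orderFiltration K (Fin n) k) (hfk' : f ∉ orderFiltration K (Fin n) (k + 1)) :
    (∃ v : FreeMonoid (Fin n), v.length = k ∧ ∑ i, letterCount v i • w i = m) ∧
      ∃ g, FreeAlgebra.lift K u g ∈ weightSpace ρ m ∧
        f - FreeAlgebra.lift K u g ∈ orderFiltration K (Fin n) (k + 1) := by
  obtain ⟨g, hfg, hg⟩ := exists_leadingForm hfk
  have hφ : ∀ i, FreeAlgebra.lift K u (FreeAlgebra.ι K i) - FreeAlgebra.ι K i ∈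
      orderFiltration K (Fin n) 2 := fun i => by
    rw [FreeAlgebra.lift_ι_apply]
    exact hu2 i
  have hgk : g ∈ orderFiltration K (Fin n) k :=
    mem_orderFiltration_iff.mpr fun v hv => hg v hv.ne
  have hDgk : ∀ t : Torus K n, diagonalEnd w t g ∈ orderFiltration K (Fin n) k := fun t =>
    mem_orderFiltration_iff.mpr fun v hv => by rw [freeCoeff_diagonalEnd, hg v hv.ne, mul_zero]
  have hφg : f - FreeAlgebra.lift K u g ∈ orderFiltration K (Fin n) (k + 1) := by
    have h := sub_mem hfg (map_sub_self_mem_orderFiltration hφ hgk)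
    rwa [sub_sub, add_sub_cancel] at h
  -- Write `φ` for the substitution, `D` for the diagonal map, `χ` for the character. Applying `ρ t`
  -- to `f ≡ φ g` gives `χ f ≡ φ (D g) ≡ D g` modulo order `k + 1`, while `χ f ≡ χ g`. Both `D g`
  -- and `χ g` are homogeneous of degree `k`, so they agree.
  have hD : ∀ t, diagonalEnd w t g = laurentMonomial m t • g := by
    intro t
    have h1 := map_mem_orderFiltration (hJ t) hφg
    rw [map_sub, comp_lift_eq_lift_comp_diagonalEnd hu, mem_weightSpace.mp hfm t] at h1
    have h2 := map_sub_self_mem_orderFiltration hφ (hDgk t)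
    have h3 := Submodule.smul_mem _ (laurentMonomial m t) hfg
    have h4 := sub_mem (add_mem h1 h2) h3
    refine freeAlgebra_ext_freeCoeff fun v => ?_
    by_cases hv : v.length = k
    · have h5 := mem_orderFiltration_iff.mp h4 v (by omega)
      simp only [map_sub, map_add, map_smul, smul_eq_mul] at h5
      rw [map_smul, smul_eq_mul]
      linear_combination -h5
    · rw [freeCoeff_diagonalEnd, map_smul, hg v hv, mul_zero, smul_zero]
  refine ⟨?_, g, fun t => ?_, hφg⟩
  · have hg0 : g ≠ 0 := by
      rintro rfl
      rw [sub_zero] at hfg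
      exact hfk' hfg
    obtain ⟨v, hv⟩ : ∃ v, freeCoeff v g ≠ 0 := by
      by_contra! h
      exact hg0 (freeAlgebra_ext_freeCoeff fun v => by rw [h v, map_zero])
    refine ⟨v, not_not.mp fun h => hv (hg v h), laurentCharacter_injective (K := K) ?_⟩
    refine MonoidHom.ext fun t => ?_
    have := congrArg (freeCoeff v) (hD t)
    rw [freeCoeff_diagonalEnd, map_smul, smul_eq_mul] at this
    exact mul_right_cancel₀ hv this
  · rw [comp_lift_eq_lift_comp_diagonalEnd hu, hD, map_smul]

theorem bijective_lift_of_weight_vectors [Infinite K]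
    (htop : ⨆ m, weightSpace ρ m = ⊤)
    (hJ : ∀ t i, ρ t (FreeAlgebra.ι K i) ∈ orderFiltration K (Fin n) 1)
    (hu : ∀ i, u i ∈ weightSpace ρ (w i))
    (hu2 : ∀ i, u i - FreeAlgebra.ι K i ∈ orderFiltration K (Fin n) 2)
    (hw : LinearIndependent ℤ w) : Function.Bijective (FreeAlgebra.lift K u) := by
  refine ⟨injective_of_sub_mem_orderFiltration fun i => ?_, ?_⟩
  · rw [FreeAlgebra.lift_ι_apply]
    exact hu2 i
  suffices h : ∀ m, weightSpace ρ m ≤ LinearMap.range (FreeAlgebra.lift K u).toLinearMap by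
    have := iSup_le h
    rw [htop, top_le_iff, LinearMap.range_eq_top] at this
    exact this
  intro m f hf
  rcases eq_or_ne f 0 with rfl | hf0
  · exact zero_mem _
  obtain ⟨k, hk, hk'⟩ := exists_order hf0
  obtain ⟨⟨v, hv, hvm⟩, g, hgm, hg⟩ := exists_weight_of_order hJ hu hu2 hf hk hk'
  refine ⟨g, ?_⟩
  change FreeAlgebra.lift K u g = f
  by_contra hne
  obtain ⟨l, hl, hl'⟩ := exists_order (sub_ne_zero.mpr (Ne.symm hne))
  obtain ⟨⟨v', hv', hvm'⟩, -⟩ := exists_weight_of_order hJ hu hu2 (sub_mem hf hgm) hl hl'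
  have hkl : k + 1 ≤ l := by
    by_contra! h
    exact hl' (orderFiltration_antitone (by omega) hg)
  -- Two words of the same weight have the same letters, hence the same length; but the lengths here
  -- are `k` and `l ≥ k + 1`.
  have hc : letterCount v = letterCount v' :=
    (linearIndependent_iff_injective_fintypeLinearCombination.mp hw) (by
      simp only [Fintype.linearCombination_apply, hvm, hvm'])
  have := sum_letterCount v
  rw [hc, sum_letterCount, hv, hv'] at this
  omega

end Core

/-! ### Invariants and fixed points in the commutative case -/

section Commutative

variable {K : Type*} [Field K] {n : ℕ}

/-- A nonzero rational functional kills the proper span; `v` is its coordinate vector with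
denominators cleared. -/
theorem exists_integer_annihilator {S : Set (Fin n → ℤ)}
    (hS : Submodule.span ℚ ((fun m j => (m j : ℚ)) '' S) ≠ ⊤) :
    ∃ v : Fin n → ℤ, v ≠ 0 ∧ ∀ m ∈ S, ∑ j, m j * v j = 0 := by
  obtain ⟨φ, hφ0, hφ⟩ := Submodule.exists_dual_map_eq_bot_of_lt_top hS.lt_top inferInstance
  obtain ⟨b, hb⟩ := IsLocalization.exist_integer_multiples_of_finite (nonZeroDivisors ℤ)
    (fun j : Fin n => φ (Pi.single j 1))
  choose v hv using hb
  have hb0 : ((b : ℤ) : ℚ) ≠ 0 := Int.cast_ne_zero.mpr (nonZeroDivisors.ne_zero b.2)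
  have hv' : ∀ j, (v j : ℚ) = (b : ℤ) * φ (Pi.single j 1) := fun j => by
    have := hv j
    simpa using this
  refine ⟨v, fun h0 => hφ0 ?_, fun m hm => ?_⟩
  · refine (Pi.basisFun ℚ (Fin n)).ext fun j => ?_
    have := hv' j
    rw [h0, Pi.zero_apply, Int.cast_zero] at this
    simpa [hb0] using this.symm
  · have h1 : φ (fun j => (m j : ℚ)) = 0 := by
      rw [← Submodule.mem_bot ℚ, ← hφ]
      exact Submodule.mem_map_of_mem (Submodule.subset_span ⟨m, hm, rfl⟩)
    rw [LinearMap.pi_apply_eq_sum_univ φ] at h1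
    have h2 : ∀ j : Fin n, (fun i => if j = i then (1 : ℚ) else 0) = Pi.single j 1 := fun j => by
      ext i
      simp [Pi.single_apply, eq_comm]
    simp only [h2, smul_eq_mul] at h1
    have h3 : ((∑ j, m j * v j : ℤ) : ℚ) = 0 := by
      push_cast
      simp only [hv']
      rw [← mul_zero ((b : ℤ) : ℚ), ← h1, Finset.mul_sum]
      exact Finset.sum_congr rfl fun j _ => by ring
    exact_mod_cast h3

variable {A : Type*} [CommRing A] [Algebra K A]
  {ρ : Torus K n → A →ₐ[K] A}

/-- If the occurring weights did not span `ℚ ^ n`, a nontrivial point of a one-parameter subgroup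
orthogonal to them would act trivially. -/
theorem exists_linearIndependent_weights [Infinite K] (htop : ⨆ m, weightSpace ρ m = ⊤)
    (heff : ∀ t, (∀ a, ρ t a = a) → t = 1) :
    ∃ w : Fin n → Fin n → ℤ, LinearIndependent ℤ w ∧ ∀ i, weightSpace ρ (w i) ≠ ⊥ := by
  have hspan : Submodule.span ℚ ((fun m j => ((m j : ℤ) : ℚ)) '' {m | weightSpace ρ m ≠ ⊥}) =
      (⊤ : Submodule ℚ (Fin n → ℚ)) := by
    by_contra hne
    obtain ⟨v, hv0, hv⟩ := exists_integer_annihilator hne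
    obtain ⟨t, ht, htm⟩ := exists_torus_ne_one (K := K) hv0
    refine ht (heff t fun a => ?_)
    suffices h : ⨆ m, weightSpace ρ m ≤ LinearMap.eqLocus (ρ t).toLinearMap LinearMap.id by
      rw [htop] at h
      exact h (Submodule.mem_top (x := a))
    refine iSup_le fun m b hb => ?_
    change ρ t b = b
    by_cases hm : weightSpace ρ m = ⊥
    · rw [hm, Submodule.mem_bot] at hb
      rw [hb, map_zero]
    · rw [mem_weightSpace.mp hb t, htm m (hv m hm), one_smul]
  obtain ⟨u, hu, hli⟩ := exists_linearIndependent_of_span_eq_top hspan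
  choose w hw hwu using hu
  refine ⟨w, ?_, hw⟩
  have hli' : LinearIndependent ℤ u := hli.restrict_scalars' ℤ
  let c : (Fin n → ℤ) →ₗ[ℤ] (Fin n → ℚ) :=
    ((Int.castAddHom ℚ).compLeft (Fin n)).toIntLinearMap
  refine LinearIndependent.of_comp c ?_
  have : c ∘ w = u := funext fun i => hwu i
  rwa [this]

theorem isAlgebraic_of_mem_weightSpace_zero [IsDomain A] [Infinite K]
    (htr : Algebra.trdeg K A ≤ n) (htop : ⨆ m, weightSpace ρ m = ⊤)
    (heff : ∀ t, (∀ a, ρ t a = a) → t = 1) {a : A} (ha : a ∈ weightSpace ρ 0) :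
    IsAlgebraic K a := by
  obtain ⟨w, hw, hW⟩ := exists_linearIndependent_weights htop heff
  have hex : ∀ i, ∃ h ∈ weightSpace ρ (w i), h ≠ 0 := fun i =>
    (Submodule.ne_bot_iff _).mp (hW i)
  choose h hh hh0 using hex
  by_contra htrans
  -- The coefficient variable goes to the supposedly transcendental `a`, the other `n` variables to
  -- the weight vectors. Distinct monomials in the latter have distinct weights, so a relation
  -- splits into single terms, each of which must vanish.
  let Φ : MvPolynomial (Fin n) (Polynomial K) →ₐ[K] A :=
    MvPolynomial.aevalTower (Polynomial.aeval a) h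
  have hinj : Function.Injective Φ := by
    rw [injective_iff_map_eq_zero]
    intro P hP
    have hP' : ∑ d ∈ P.support, Polynomial.aeval a (P.coeff d) * ∏ i, h i ^ d i = 0 := by
      rw [← hP]
      exact (MvPolynomial.eval₂_eq' _ _ _).symm
    let wt : (Fin n →₀ ℕ) → Fin n → ℤ := fun d => ∑ i, (d i : ℤ) • w i
    have hwt : Function.Injective wt := by
      intro d d' hd
      have := (linearIndependent_iff_injective_fintypeLinearCombination.mp hw)
        (a₁ := fun i => (d i : ℤ)) (a₂ := fun i => (d' i : ℤ)) (by
          simpa only [Fintype.linearCombination_apply] using hd)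
      ext i
      exact_mod_cast congrFun this i
    have hmem : ∀ d : Fin n →₀ ℕ,
        Polynomial.aeval a (P.coeff d) * ∏ i, h i ^ d i ∈ weightSpace ρ (wt d) := by
      intro d
      have h1 : Polynomial.aeval a (P.coeff d) ∈ weightSpace ρ 0 := by
        rw [mem_weightSpace]
        intro t
        rw [← Polynomial.aeval_algHom_apply, mem_weightSpace.mp ha t, laurentMonomial_zero,
          one_smul, one_smul]
      have h2 : ∀ s : Finset (Fin n),
          ∏ i ∈ s, h i ^ d i ∈ weightSpace ρ (∑ i ∈ s, (d i : ℤ) • w i) := by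
        intro s
        induction s using Finset.cons_induction with
        | empty => simpa using one_mem_weightSpace_zero ρ
        | cons i s hi ih =>
          rw [Finset.prod_cons, Finset.sum_cons, natCast_zsmul]
          exact mul_mem_weightSpace (pow_mem_weightSpace (hh i) _) ih
      have := mul_mem_weightSpace h1 (h2 Finset.univ)
      rwa [zero_add] at this
    have hzero := (iSupIndep_iff_finsetSum_eq_zero_imp_eq_zero _).mp
      ((iSupIndep_weightSpace ρ).comp hwt) P.support _ (fun d _ => hmem d) hP'
    ext1 d
    rw [MvPolynomial.coeff_zero]
    by_cases hd : d ∈ P.support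
    · have h1 := hzero d hd
      rcases mul_eq_zero.mp h1 with h2 | h2
      · exact transcendental_iff.mp htrans _ h2
      · obtain ⟨i, _, hi⟩ := Finset.prod_eq_zero_iff.mp h2
        exact absurd hi (pow_ne_zero _ (hh0 i))
    · exact MvPolynomial.notMem_support_iff.mp hd
  have hle := lift_trdeg_le_of_injective
    (Φ.comp (MvPolynomial.optionEquivRight K (Fin n)).toAlgHom)
    (hinj.comp (MvPolynomial.optionEquivRight K (Fin n)).injective)
  have h1 := hle.trans (Cardinal.lift_le.mpr htr)
  rw [MvPolynomial.trdeg_of_isDomain] at h1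
  simp only [Cardinal.mk_fintype, Fintype.card_option, Fintype.card_fin, Cardinal.lift_natCast,
    Nat.cast_le] at h1
  omega

theorem exists_invariant_augmentation [IsDomain A] [IsAlgClosed K]
    (hunit : ∀ a : A, IsUnit a → a ∈ (algebraMap K A).range)
    (htr : Algebra.trdeg K A ≤ n) (htop : ⨆ m, weightSpace ρ m = ⊤)
    (heff : ∀ t, (∀ a, ρ t a = a) → t = 1) :
    ∃ ε : A →ₐ[K] K, ∀ t a, ε (ρ t a) = ε a := by
  have : Infinite K := IsAlgClosed.instInfinite
  have hconst : ∀ a ∈ weightSpace ρ 0, a ∈ (algebraMap K A).range := fun a ha =>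
    minpoly.mem_range_of_degree_eq_one K a (IsAlgClosed.degree_eq_one_of_irreducible K
      (minpoly.irreducible (isAlgebraic_of_mem_weightSpace_zero htr htop heff ha).isIntegral))
  let N : Submodule K A := ⨆ m ≠ 0, weightSpace ρ m
  have hdisj : Disjoint (weightSpace ρ 0) N := iSupIndep_weightSpace ρ 0
  have hmul : ∀ a : A, ∀ x ∈ N, a * x ∈ N := by
    intro a x hx
    have ha : a ∈ ⨆ m, weightSpace ρ m := htop ▸ Submodule.mem_top
    refine Submodule.iSup_induction (weightSpace ρ) (motive := fun a => a * x ∈ N) ha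
      (fun m a ha => ?_) (by rw [zero_mul]; exact zero_mem _)
      (fun a b ha hb => by rw [add_mul]; exact add_mem ha hb)
    · suffices h : N ≤ N.comap (LinearMap.mulLeft K a) from h hx
      refine iSup₂_le fun m' hm' b hb => ?_
      change a * b ∈ N
      have hab := mul_mem_weightSpace ha hb
      -- In weight `0` the product is constant. Were it nonzero, `b` would be a unit, hence constant
      -- and of weight `0`, contrary to `m' ≠ 0`.
      by_cases h0 : m + m' = 0
      · rw [h0] at hab
        obtain ⟨c, hc⟩ := hconst _ hab
        suffices a * b = 0 by rw [this]; exact zero_mem _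
        by_contra hne
        have hc0 : c ≠ 0 := by
          rintro rfl
          exact hne (by rw [← hc, map_zero])
        have hbu : IsUnit b := isUnit_of_mul_isUnit_right
          (hc ▸ (isUnit_iff_ne_zero.mpr hc0).map (algebraMap K A))
        obtain ⟨d, hd⟩ := hunit b hbu
        have hb0 : b ∈ weightSpace ρ 0 := hd ▸ algebraMap_mem_weightSpace_zero ρ d
        have := Submodule.disjoint_def.mp ((iSupIndep_weightSpace ρ).pairwiseDisjoint hm') b hb hb0
        exact hne (by rw [this, mul_zero])
      · exact Submodule.mem_iSup_of_mem _ (Submodule.mem_iSup_of_mem h0 hab)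
  let M : Ideal A :=
    { carrier := N
      add_mem' := fun ha hb => N.add_mem ha hb
      zero_mem' := N.zero_mem
      smul_mem' := hmul }
  have hcod : ∀ a : A, ∃ c : K, a - algebraMap K A c ∈ M := by
    intro a
    have ha : a ∈ ⨆ m, weightSpace ρ m := htop ▸ Submodule.mem_top
    refine Submodule.iSup_induction (weightSpace ρ)
      (motive := fun a => ∃ c : K, a - algebraMap K A c ∈ M) ha
      (fun m a ha => ?_) ⟨0, by simp⟩ (fun a b ha hb => ?_)
    rotate_left
    · obtain ⟨c, hc⟩ := ha
      obtain ⟨d, hd⟩ := hb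
      refine ⟨c + d, ?_⟩
      rw [map_add, add_sub_add_comm]
      exact add_mem hc hd
    · by_cases hm : m = 0
      · subst hm
        obtain ⟨c, hc⟩ := hconst a ha
        exact ⟨c, by rw [hc, sub_self]; exact zero_mem _⟩
      · refine ⟨0, ?_⟩
        rw [map_zero, sub_zero]
        exact Submodule.mem_iSup_of_mem (p := fun m => ⨆ _ : m ≠ 0, weightSpace ρ m) m
          (Submodule.mem_iSup_of_mem hm ha)
  have hM1 : M ≠ ⊤ := by
    rw [Ideal.ne_top_iff_one]
    intro h1
    exact one_ne_zero (Submodule.disjoint_def.mp hdisj 1 (one_mem_weightSpace_zero ρ) h1)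
  have : Nontrivial (A ⧸ M) := Ideal.Quotient.nontrivial_iff.mpr hM1
  have hbij : Function.Bijective (Algebra.ofId K (A ⧸ M)) := by
    refine ⟨(algebraMap K (A ⧸ M)).injective, fun x => ?_⟩
    obtain ⟨a, rfl⟩ := Ideal.Quotient.mk_surjective x
    obtain ⟨c, hc⟩ := hcod a
    exact ⟨c, ((Ideal.Quotient.mk_eq_mk_iff_sub_mem _ _).mpr hc).symm⟩
  let e := AlgEquiv.ofBijective (Algebra.ofId K (A ⧸ M)) hbij
  refine ⟨e.symm.toAlgHom.comp (Ideal.Quotient.mkₐ K M), fun t a => ?_⟩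
  change e.symm (Ideal.Quotient.mk M (ρ t a)) = e.symm (Ideal.Quotient.mk M a)
  congr 1
  rw [Ideal.Quotient.mk_eq_mk_iff_sub_mem]
  have hN : ∀ x ∈ N, ρ t x ∈ N := by
    suffices h : N ≤ N.comap (ρ t).toLinearMap from fun x hx => h hx
    refine iSup₂_le fun m hm b hb => ?_
    change ρ t b ∈ N
    rw [mem_weightSpace.mp hb t]
    exact Submodule.smul_mem _ _
      (Submodule.mem_iSup_of_mem m (Submodule.mem_iSup_of_mem hm hb))
  obtain ⟨c, hc⟩ := hcod a
  have h1 := M.sub_mem (hN _ hc) hc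
  rwa [map_sub, AlgHom.commutes, sub_sub_sub_cancel_right] at h1

end Commutative

/-! ### Conjugation, the fixed origin and the final linearization -/

section Linearization

variable {K : Type*} [Field K] {n : ℕ}

/-- The endomorphisms underlying an action by automorphisms. -/
def actionEnd {A : Type*} [Ring A] [Algebra K A] (σ : Torus K n →* (A ≃ₐ[K] A)) (t : Torus K n) :
    A →ₐ[K] A := (σ t).toAlgHom

theorem actionEnd_apply {A : Type*} [Ring A] [Algebra K A] (σ : Torus K n →* (A ≃ₐ[K] A))
    (t : Torus K n) (a : A) : actionEnd σ t a = σ t a := rfl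

theorem IsRegularAction.iSup_weightSpace [Infinite K] {A : Type*} [Ring A] [Algebra K A]
    {σ : Torus K n →* (A ≃ₐ[K] A)} (hσ : IsRegularAction σ) :
    ⨆ m, weightSpace (actionEnd σ) m = ⊤ := by
  refine iSup_weightSpace_eq_top (fun a => ?_) (fun s t a => ?_) hσ
  · rw [actionEnd_apply, map_one]
    rfl
  · rw [actionEnd_apply, map_mul]
    rfl

theorem IsEffectiveAction.eq_one [Infinite K] {A : Type*} [Ring A] [Algebra K A]
    {σ : Torus K n →* (A ≃ₐ[K] A)} (hσ : IsRegularAction σ) (heff : IsEffectiveAction σ)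
    {t : Torus K n}
    (h : ∀ m, ∀ a ∈ weightSpace (actionEnd σ) m, a ≠ 0 → laurentMonomial m t = 1) : t = 1 := by
  by_contra ht
  obtain ⟨a, ha⟩ := heff t ht
  apply ha
  suffices h' : ⨆ m, weightSpace (actionEnd σ) m ≤
      LinearMap.eqLocus (actionEnd σ t).toLinearMap LinearMap.id by
    rw [hσ.iSup_weightSpace] at h'
    exact h' (Submodule.mem_top (x := a))
  refine iSup_le fun m b hb => ?_
  change actionEnd σ t b = b
  rcases eq_or_ne b 0 with rfl | hb0
  · exact map_zero _
  · rw [mem_weightSpace.mp hb t, h m b hb hb0, one_smul]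

/-- The action conjugated by an automorphism. -/
def conjAction {A : Type*} [Ring A] [Algebra K A] (σ : Torus K n →* (A ≃ₐ[K] A))
    (α : A ≃ₐ[K] A) : Torus K n →* (A ≃ₐ[K] A) :=
  (MulAut.conj α⁻¹).toMonoidHom.comp σ

theorem conjAction_eq {A : Type*} [Ring A] [Algebra K A] (σ : Torus K n →* (A ≃ₐ[K] A))
    (α : A ≃ₐ[K] A) (t : Torus K n) : conjAction σ α t = α⁻¹ * σ t * α := by
  simp [conjAction]

theorem conjAction_apply {A : Type*} [Ring A] [Algebra K A] (σ : Torus K n →* (A ≃ₐ[K] A))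
    (α : A ≃ₐ[K] A) (t : Torus K n) (a : A) : conjAction σ α t a = α.symm (σ t (α a)) := by
  rw [conjAction_eq]
  rfl

theorem IsRegularAction.conj {A : Type*} [Ring A] [Algebra K A] {σ : Torus K n →* (A ≃ₐ[K] A)}
    (hσ : IsRegularAction σ) (α : A ≃ₐ[K] A) : IsRegularAction (conjAction σ α) := by
  intro a
  obtain ⟨c, hc⟩ := hσ (α a)
  refine ⟨c.mapRange α.symm (map_zero _), fun t => ?_⟩
  rw [conjAction_apply, hc, Finsupp.sum_mapRange_index (by simp), Finsupp.sum, map_sum]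
  simp only [map_smul]
  rfl

theorem IsEffectiveAction.conj {A : Type*} [Ring A] [Algebra K A] {σ : Torus K n →* (A ≃ₐ[K] A)}
    (hσ : IsEffectiveAction σ) (α : A ≃ₐ[K] A) : IsEffectiveAction (conjAction σ α) := by
  intro t ht
  obtain ⟨a, ha⟩ := hσ t ht
  refine ⟨α.symm a, fun h => ha ?_⟩
  rw [conjAction_apply, AlgEquiv.apply_symm_apply] at h
  exact α.symm.injective h

theorem IsLinearizable.of_conj
    {σ : Torus K n →* (FreeAlgebra K (Fin n) ≃ₐ[K] FreeAlgebra K (Fin n))}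
    {α : FreeAlgebra K (Fin n) ≃ₐ[K] FreeAlgebra K (Fin n)}
    (h : IsLinearizable (conjAction σ α)) : IsLinearizable σ := by
  obtain ⟨β, τ, hτ, hβ⟩ := h
  refine ⟨α * β, τ, hτ, fun t => ?_⟩
  rw [hβ, conjAction_eq]
  group

variable {σ : Torus K n →* (FreeAlgebra K (Fin n) ≃ₐ[K] FreeAlgebra K (Fin n))}

/-- Linearizability in the presence of weight vectors tangent to the generators. -/
theorem isLinearizable_of_weight_vectors [Infinite K] (hreg : IsRegularAction σ)
    (heff : IsEffectiveAction σ)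
    (hJ : ∀ t i, σ t (FreeAlgebra.ι K i) ∈ orderFiltration K (Fin n) 1)
    {u : Fin n → FreeAlgebra K (Fin n)} {w : Fin n → Fin n → ℤ}
    (hu : ∀ i, u i ∈ weightSpace (actionEnd σ) (w i))
    (hu2 : ∀ i, u i - FreeAlgebra.ι K i ∈ orderFiltration K (Fin n) 2) : IsLinearizable σ := by
  have hw : LinearIndependent ℤ w := by
    refine Matrix.linearIndependent_rows_of_det_ne_zero (A := Matrix.of w) fun hdet => ?_
    -- Every occurring weight is a combination of the `w i`, so a kernel vector `v` is orthogonal to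
    -- all of them and yields a nontrivial point acting trivially.
    obtain ⟨v, hv0, hv⟩ := Matrix.exists_mulVec_eq_zero_iff.mpr hdet
    obtain ⟨t, ht, htm⟩ := exists_torus_ne_one (K := K) hv0
    refine ht (heff.eq_one hreg fun m f hf hf0 => htm m ?_)
    obtain ⟨k, hk, hk'⟩ := exists_order hf0
    obtain ⟨⟨x, -, hx⟩, -⟩ := exists_weight_of_order hJ hu hu2 hf hk hk'
    rw [← hx]
    simp only [Finset.sum_apply, Pi.smul_apply, smul_eq_mul, Finset.sum_mul]
    rw [Finset.sum_comm]
    refine Finset.sum_eq_zero fun i _ => ?_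
    have hi : ∑ j, w i j * v j = 0 := congrFun hv i
    simp only [mul_assoc]
    rw [← Finset.mul_sum, hi, mul_zero]
  let β := AlgEquiv.ofBijective (FreeAlgebra.lift K u)
    (bijective_lift_of_weight_vectors hreg.iSup_weightSpace hJ hu hu2 hw)
  have hβ : ∀ i, β (FreeAlgebra.ι K i) = u i := fun i => FreeAlgebra.lift_ι_apply _ _
  refine ⟨β, conjAction σ β, ⟨w, fun t i => ?_⟩, conjAction_eq σ β⟩
  rw [conjAction_apply, hβ, ← actionEnd_apply, mem_weightSpace.mp (hu i) t, map_smul, ← hβ,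
    AlgEquiv.symm_apply_apply]

/-- The endomorphism of the free algebra given by a linear substitution. -/
noncomputable def linearEnd (B : Matrix (Fin n) (Fin n) K) :
    FreeAlgebra K (Fin n) →ₐ[K] FreeAlgebra K (Fin n) :=
  FreeAlgebra.lift K fun i => ∑ j, B i j • FreeAlgebra.ι K j

theorem linearEnd_ι (B : Matrix (Fin n) (Fin n) K) (i : Fin n) :
    linearEnd B (FreeAlgebra.ι K i) = ∑ j, B i j • FreeAlgebra.ι K j := by
  simp [linearEnd]

/-- The order of the factors is reversed because the rows of the matrices are the images of the
generators. -/
theorem linearEnd_comp (B C : Matrix (Fin n) (Fin n) K) :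
    (linearEnd B).comp (linearEnd C) = linearEnd (C * B) := by
  ext i
  simp only [Function.comp_apply, AlgHom.coe_comp, linearEnd_ι, map_sum, map_smul, Finset.smul_sum,
    smul_smul, Matrix.mul_apply, Finset.sum_smul]
  exact Finset.sum_comm

theorem linearEnd_one : linearEnd (1 : Matrix (Fin n) (Fin n) K) = AlgHom.id K _ := by
  ext i
  simp [linearEnd_ι, Matrix.one_apply]

/-- The automorphism of the free algebra given by an invertible linear substitution. -/
noncomputable def linearAut (B : Matrix (Fin n) (Fin n) K) (hB : IsUnit B.det) :
    FreeAlgebra K (Fin n) ≃ₐ[K] FreeAlgebra K (Fin n) :=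
  AlgEquiv.ofAlgHom (linearEnd B) (linearEnd B⁻¹)
    (by rw [linearEnd_comp, Matrix.nonsing_inv_mul B hB, linearEnd_one])
    (by rw [linearEnd_comp, Matrix.mul_nonsing_inv B hB, linearEnd_one])

theorem linearEnd_ι_mem (B : Matrix (Fin n) (Fin n) K) (i : Fin n) :
    linearEnd B (FreeAlgebra.ι K i) ∈ orderFiltration K (Fin n) 1 := by
  rw [linearEnd_ι]
  exact Submodule.sum_mem _ fun j _ => Submodule.smul_mem _ _ (ι_mem_orderFiltration j)

/-- The automorphism of the free algebra translating the generators by scalars. -/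
noncomputable def translationAut (p : Fin n → K) :
    FreeAlgebra K (Fin n) ≃ₐ[K] FreeAlgebra K (Fin n) :=
  AlgEquiv.ofAlgHom
    (FreeAlgebra.lift K fun i => FreeAlgebra.ι K i + algebraMap K _ (p i))
    (FreeAlgebra.lift K fun i => FreeAlgebra.ι K i - algebraMap K _ (p i))
    (by ext i; simp) (by ext i; simp)

theorem translationAut_ι (p : Fin n → K) (i : Fin n) : translationAut p (FreeAlgebra.ι K i) =
    FreeAlgebra.ι K i + algebraMap K _ (p i) :=
  FreeAlgebra.lift_ι_apply _ _

theorem sub_smul_one_mem_orderFiltration (f : FreeAlgebra K (Fin n)) :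
    f - freeCoeff 1 f • 1 ∈ orderFiltration K (Fin n) 1 := by
  classical
  rw [mem_orderFiltration_one_iff, map_sub, map_smul, ← map_one (freeWord K), freeCoeff_freeWord]
  simp

theorem freeCoeff_of_ι (i j : Fin n) :
    freeCoeff (FreeMonoid.of j) (FreeAlgebra.ι K i) = if i = j then 1 else 0 := by
  classical
  rw [← freeWord_of, freeCoeff_freeWord]
  simp [FreeMonoid.of_injective.eq_iff]

theorem freeCoeff_of_one (j : Fin n) :
    freeCoeff (FreeMonoid.of j) (1 : FreeAlgebra K (Fin n)) = 0 := by
  classical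
  rw [← map_one (freeWord K), freeCoeff_freeWord, if_neg]
  exact fun h => FreeMonoid.of_ne_one j h.symm

/-- If the action fixes the origin, there are weight vectors without constant term whose linear
parts form a basis. -/
theorem exists_weight_vectors [Infinite K] (hreg : IsRegularAction σ)
    (hJ : ∀ t i, σ t (FreeAlgebra.ι K i) ∈ orderFiltration K (Fin n) 1) :
    ∃ (u : Fin n → FreeAlgebra K (Fin n)) (w : Fin n → Fin n → ℤ),
      (∀ i, u i ∈ weightSpace (actionEnd σ) (w i)) ∧
      (∀ i, u i ∈ orderFiltration K (Fin n) 1) ∧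
      LinearIndependent K fun i j => freeCoeff (FreeMonoid.of j) (u i) := by
  let lin : FreeAlgebra K (Fin n) →ₗ[K] Fin n → K :=
    LinearMap.pi fun j => freeCoeff (FreeMonoid.of j)
  let S : Set (Fin n → K) :=
    {x | ∃ m, ∃ f ∈ weightSpace (actionEnd σ) m, f ∈ orderFiltration K (Fin n) 1 ∧ lin f = x}
  have hS : ⨆ m, weightSpace (actionEnd σ) m ≤ (Submodule.span K S).comap lin := by
    refine iSup_le fun m f hf => Submodule.subset_span ?_
    have hc := sub_smul_one_mem_orderFiltration f
    -- Dropping the constant term keeps the weight: since the origin is fixed, comparing constant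
    -- terms shows that the constant term is nonzero only if the character is trivial.
    refine ⟨m, f - freeCoeff 1 f • 1, fun t => ?_, hc, ?_⟩
    · have h1 := map_mem_orderFiltration (φ := actionEnd σ t) (hJ t) hc
      rw [mem_orderFiltration_one_iff] at h1 hc
      rw [map_sub, map_smul, map_one, mem_weightSpace.mp hf t] at h1 ⊢
      rw [map_sub] at h1 hc
      have h2 : laurentMonomial m t * freeCoeff 1 f = freeCoeff 1 f := by
        rw [map_smul, smul_eq_mul] at h1
        linear_combination h1 - hc
      rw [smul_sub, smul_smul, h2]
    · ext j
      change freeCoeff _ _ = freeCoeff _ _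
      rw [map_sub, map_smul, freeCoeff_of_one, smul_zero, sub_zero]
  rw [hreg.iSup_weightSpace] at hS
  have hspan : Submodule.span K S = ⊤ := by
    rw [eq_top_iff, ← (Pi.basisFun K (Fin n)).span_eq, Submodule.span_le]
    rintro _ ⟨i, rfl⟩
    have : Pi.basisFun K (Fin n) i = lin (FreeAlgebra.ι K i) := by
      ext j
      rw [Pi.basisFun_apply, Pi.single_apply]
      change _ = freeCoeff _ _
      rw [freeCoeff_of_ι]
      simp only [eq_comm]
    rw [this]
    exact hS Submodule.mem_top
  obtain ⟨x, hx, hli⟩ := exists_linearIndependent_of_span_eq_top hspan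
  choose w u hu hu1 hux using hx
  refine ⟨u, w, hu, hu1, ?_⟩
  have : (fun i j => freeCoeff (FreeMonoid.of j) (u i)) = x := funext fun i => hux i
  rwa [this]

theorem isLinearizable_of_fixed_origin [Infinite K] (hreg : IsRegularAction σ)
    (heff : IsEffectiveAction σ)
    (hJ : ∀ t i, σ t (FreeAlgebra.ι K i) ∈ orderFiltration K (Fin n) 1) : IsLinearizable σ := by
  obtain ⟨u, w, hu, hu1, hli⟩ := exists_weight_vectors hreg hJ
  let B : Matrix (Fin n) (Fin n) K := Matrix.of fun i j => freeCoeff (FreeMonoid.of j) (u i)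
  have hB : IsUnit B.det := by
    rw [← Matrix.isUnit_iff_isUnit_det]
    exact Matrix.linearIndependent_rows_iff_isUnit.mp hli
  let α := linearAut B hB
  have hα : ∀ i, α (FreeAlgebra.ι K i) = ∑ j, B i j • FreeAlgebra.ι K j := linearEnd_ι B
  have hαJ : ∀ i, α (FreeAlgebra.ι K i) ∈ orderFiltration K (Fin n) 1 := linearEnd_ι_mem B
  have hα' : ∀ {k f}, f ∈ orderFiltration K (Fin n) k →
      α.symm f ∈ orderFiltration K (Fin n) k := fun hf =>
    map_mem_orderFiltration (φ := linearEnd B⁻¹) (linearEnd_ι_mem B⁻¹) hf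
  refine IsLinearizable.of_conj (α := α) (isLinearizable_of_weight_vectors (hreg.conj α)
    (heff.conj α) (fun t i => ?_) (u := fun i => α.symm (u i)) (w := w) (fun i t => ?_)
    fun i => ?_)
  · rw [conjAction_apply]
    exact hα' (map_mem_orderFiltration (φ := actionEnd σ t) (hJ t) (hαJ i))
  · rw [actionEnd_apply, conjAction_apply, AlgEquiv.apply_symm_apply, ← actionEnd_apply,
      mem_weightSpace.mp (hu i) t, map_smul]
  · have h : u i - α (FreeAlgebra.ι K i) ∈ orderFiltration K (Fin n) 2 := by
      rw [mem_orderFiltration_two_iff]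
      refine ⟨?_, fun j => ?_⟩
      · exact mem_orderFiltration_one_iff.mp (sub_mem (hu1 i) (hαJ i))
      · rw [map_sub, hα, map_sum]
        simp [freeCoeff_of_ι, B]
    have := hα' h
    rwa [map_sub, AlgEquiv.symm_apply_apply] at this

/-- Effectiveness survives abelianization: such a `t` changes generators only in order at least two,
so it preserves leading forms, and the scalar by which it acts on any nonzero weight vector must be
`1`. -/
theorem eq_one_of_abelianization_eq [Infinite K] (hreg : IsRegularAction σ)
    (heff : IsEffectiveAction σ) {t : Torus K n}
    (ht : ∀ i, abelianization K (Fin n) (σ t (FreeAlgebra.ι K i)) = MvPolynomial.X i) : t = 1 := by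
  refine heff.eq_one hreg fun m f hf hf0 => ?_
  obtain ⟨k, hk, hk'⟩ := exists_order hf0
  have h := map_sub_self_mem_orderFiltration (φ := actionEnd σ t) (fun i =>
    mem_orderFiltration_two_of_abelianization_eq_zero (by
      rw [actionEnd_apply, map_sub, ht, abelianization_ι, sub_self])) hk
  rw [mem_weightSpace.mp hf t] at h
  by_contra hne
  have h' : (laurentMonomial m t - 1) • f ∈ orderFiltration K (Fin n) (k + 1) := by
    rwa [sub_smul, one_smul]
  exact hk' ((Submodule.smul_mem_iff _ (sub_ne_zero.mpr hne)).mp h')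

theorem abelianization_surjective : Function.Surjective (abelianization K (Fin n)) := by
  rw [← AlgHom.range_eq_top, eq_top_iff, ← MvPolynomial.adjoin_range_X, Algebra.adjoin_le_iff]
  rintro _ ⟨i, rfl⟩
  exact ⟨FreeAlgebra.ι K i, abelianization_ι i⟩

/-- An effective regular action has a fixed point in affine space. -/
theorem exists_invariant_point [IsAlgClosed K] (hreg : IsRegularAction σ)
    (heff : IsEffectiveAction σ) :
    ∃ ε : FreeAlgebra K (Fin n) →ₐ[K] K, ∀ t f, ε (σ t f) = ε f := by
  let ρ : Torus K n → MvPolynomial (Fin n) K →ₐ[K] MvPolynomial (Fin n) K := fun t =>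
    MvPolynomial.aeval fun i => abelianization K (Fin n) (σ t (FreeAlgebra.ι K i))
  have hρ : ∀ t f, ρ t (abelianization K (Fin n) f) = abelianization K (Fin n) (σ t f) := by
    intro t f
    have : (ρ t).comp (abelianization K (Fin n)) =
        (abelianization K (Fin n)).comp (actionEnd σ t) := by
      ext1
      funext i
      simp [ρ, abelianization_ι, actionEnd_apply]
    exact DFunLike.congr_fun this f
  have htop : ⨆ m, weightSpace ρ m = ⊤ := by
    rw [eq_top_iff, ← LinearMap.range_eq_top.mpr
      (show Function.Surjective (abelianization K (Fin n)).toLinearMap from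
        abelianization_surjective), LinearMap.range_eq_map, ← hreg.iSup_weightSpace,
      Submodule.map_iSup]
    refine iSup_mono fun m => ?_
    rintro _ ⟨f, hf, rfl⟩ t
    change ρ t (abelianization K (Fin n) f) = laurentMonomial m t • abelianization K (Fin n) f
    rw [hρ, ← actionEnd_apply, mem_weightSpace.mp hf t, map_smul]
  obtain ⟨ε, hε⟩ := exists_invariant_augmentation (ρ := ρ)
    (fun a ha => by
      obtain ⟨c, -, hc⟩ := MvPolynomial.isUnit_iff_eq_C_of_isReduced.mp ha
      exact ⟨c, hc.symm⟩)
    (by rw [MvPolynomial.trdeg_of_isDomain]; simp) htop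
    (fun t ht => eq_one_of_abelianization_eq hreg heff fun i => by
      rw [← hρ, ht, abelianization_ι])
  refine ⟨ε.comp (abelianization K (Fin n)), fun t f => ?_⟩
  rw [AlgHom.comp_apply, AlgHom.comp_apply, ← hρ, hε]

theorem IsRegularAction.isLinearizable [IsAlgClosed K] (hreg : IsRegularAction σ)
    (heff : IsEffectiveAction σ) : IsLinearizable σ := by
  obtain ⟨ε, hε⟩ := exists_invariant_point hreg heff
  -- The sign makes `ε ∘ α` kill every generator, so `ε ∘ α` is the constant term and the conjugated
  -- action fixes the origin.
  let α := translationAut fun i => -ε (FreeAlgebra.ι K i)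
  have hα : ∀ f, freeCoeff 1 (α.symm f) = ε f := by
    intro f
    obtain ⟨g, rfl⟩ := α.surjective f
    rw [AlgEquiv.symm_apply_apply]
    have h : (MvPolynomial.aeval fun _ => (0 : K)).comp (abelianization K (Fin n)) =
        ε.comp α.toAlgHom := by
      ext1
      funext i
      change MvPolynomial.aeval (fun _ => (0 : K)) (abelianization K (Fin n) (FreeAlgebra.ι K i)) =
        ε (α (FreeAlgebra.ι K i))
      rw [abelianization_ι, MvPolynomial.aeval_X, translationAut_ι, map_add, AlgHom.commutes]
      simp
    have h' : MvPolynomial.aeval (fun _ => (0 : K)) (abelianization K (Fin n) g) = ε (α g) :=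
      DFunLike.congr_fun h g
    rw [← h', freeCoeff_one_eq, MvPolynomial.aeval_zero', MvPolynomial.constantCoeff_eq]
    rfl
  refine IsLinearizable.of_conj (α := α) (isLinearizable_of_fixed_origin (hreg.conj α)
    (heff.conj α) fun t i => ?_)
  rw [mem_orderFiltration_one_iff, conjAction_apply, hα, hε, ← hα, AlgEquiv.symm_apply_apply]
  exact mem_orderFiltration_one_iff.mp (ι_mem_orderFiltration i)

end Linearization

end FreeTorus

theorem mainTheorem1 {K : Type*} [Field K] [IsAlgClosed K] (n : ℕ)
    (σ : FreeTorus.Torus K n →* (FreeAlgebra K (Fin n) ≃ₐ[K] FreeAlgebra K (Fin n)))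
    (hreg : FreeTorus.IsRegularAction σ) (heff : FreeTorus.IsEffectiveAction σ) :
    FreeTorus.IsLinearizable σ :=
  hreg.isLinearizable heff
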